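/- Let $\mathbb F$ be a field of positive characteristic $\ell$ and let $n=p^m$ with $p$ prime and $m\ge 1$. Assume $\ell\notin\{2,3,p\}$, and that either 1. $p=2$ and $-1$ is a square in $\mathbb F$, or 2. $p>2$ and $\mathbb F$ contains a primitive $p$-th root of unity. Then $\mathfrak{sl}_n(\mathbb F)$ has a classical orthogonal decomposition (COD), i.e. a vector space decomposition $$\mathfrak{sl}_n(\mathbb F)=H_0\oplus H_1\oplus\cdots\oplus H_n$$ into classical Cartan subalgebras that are pairwise orthogonal for the Killing form $K(A,B)=\mathrm{Tr}(\mathrm{ad}\,A\,\mathrm{ad}\,B)$. Here a classical Cartan subalgebra of a Lie algebra $L$ over $\mathbb F$ is an abelian Cartan subalgebra $H$ (nilpotent and self-normalizing) such that, with $L_\alpha=\{x\in L: [x,h]=\alpha(h)x\ \text{for all } h\in H\}$ for $\alpha\in H^*$, and with $\alpha$ called a root if $L_\alpha\ne 0$ (so $\alpha=0$ is allowed): (a) $L=\bigoplus_{\alpha\in H^*} L_\alpha$; (b) $[L_\alpha,L_{-\alpha}]$ is one-dimensional for every root $\alpha\neq 0$; (c) if $\alpha,\beta$ are roots and $\beta\ne0$,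 then not all $\alpha+k\beta$ with $1\le k\le \ell-1$ are roots. Moreover, the $J$-decomposition is such a decomposition. Precisely, let $u\in\mathbb F$ be a primitive $p$-th root of unity (so $u=-1$ if $p=2$), let $D=\mathrm{diag}(1,u,\dots,u^{p-1})$, let $P$ be the $p\times p$ permutation matrix whose $j$-th column has its entry $1$ in row $j+1$ modulo $p$, and put $J_{(a,b)}=D^aP^b$ for $a,b\in\mathbb Z/p$. Let $(e_i)_{i=1}^m$ and $(f_i)_{i=1}^m$ be bases of $\mathbb F_{p^m}$ over $\mathbb F_p$ that are dual for the trace form, $\mathrm{Tr}_{\mathbb F_{p^m}/\mathbb F_p}(e_if_j)=\delta_{ij}$ for all $i,j$. For $x=\sum_i a_ie_i$ and $y=\sum_i b_if_i$ put $\mathcal J_{(x;y)}=J_{(a_1,b_1)}\otimes\cdots\otimes J_{(a_m,b_m)}$ (Kronecker product). Then the $n+1$ subspaces $$H_\infty=\langle \mathcal J_{(0;t)}: t\in\mathbb F_{p^m}^\times\rangle_{\mathbb F},\qquad H_\alpha=\langle \mathcal J_{(t;\alpha t)}: t\in\mathbb F_{p^m}^\times\rangle_{\mathbb F}\quad(\alpha\in\mathbb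 F_{p^m})$$ form a COD of $\mathfrak{sl}_n(\mathbb F)$. -/

import Mathlib

section LieAlgebraPart

variable {F L : Type*} [Field F] [LieRing L] [LieAlgebra F L]

/-- The space of `x` in `L` with `[x, h] = α(h) x` for all `h` in `H`
(an honest simultaneous eigenspace, not a generalized one). -/
def rootSpaceOf (H : LieSubalgebra F L) (α : Module.Dual F H) : Submodule F L where
  carrier := {x | ∀ h : H, ⁅x, (h : L)⁆ = α h • x}
  zero_mem' := by intro h; simp
  add_mem' := by
    intro x y hx hy h
    rw [add_lie, hx h, hy h, smul_add]
  smul_mem' := by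
    intro c x hx h
    rw [smul_lie, hx h, smul_comm]

/-- `α` is a root with respect to `H` when its space is nonzero; the zero functional is allowed. -/
def IsRootOf (H : LieSubalgebra F L) (α : Module.Dual F H) : Prop :=
  rootSpaceOf H α ≠ ⊥

/-- `[A, B]`, the linear span of all brackets `[x, y]` with `x` in `A` and `y` in `B`. -/
def bracketSpan (A B : Submodule F L) : Submodule F L :=
  Submodule.span F {z | ∃ x ∈ A, ∃ y ∈ B, z = ⁅x, y⁆}

/-- Classical Cartan subalgebras of a Lie algebra over a field of positive characteristic. -/
structure IsClassicalCartan (H : LieSubalgebra F L) : Prop where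
  isCartan : H.IsCartanSubalgebra
  abelian : IsLieAbelian H
  root_independent : iSupIndep (rootSpaceOf H)
  root_iSup_eq_top : ⨆ α, rootSpaceOf H α = ⊤
  finrank_bracket : ∀ α : Module.Dual F H, α ≠ 0 → IsRootOf H α →
    Module.finrank F (bracketSpan (rootSpaceOf H α) (rootSpaceOf H (-α))) = 1
  not_all_roots : ∀ α β : Module.Dual F H, IsRootOf H α → IsRootOf H β → β ≠ 0 →
    ∃ k : ℕ, 1 ≤ k ∧ k < ringChar F ∧ ¬ IsRootOf H (α + k • β)

/-- The family `H` is a classical orthogonal decomposition of `L`: its members are classical Cartan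
subalgebras, `L` is their direct sum as a vector space, and they are pairwise orthogonal for the
Killing form. -/
structure IsCOD {ι : Type*} (H : ι → LieSubalgebra F L) : Prop where
  classical : ∀ i, IsClassicalCartan (H i)
  independent : iSupIndep fun i => (H i).toSubmodule
  iSup_eq_top : ⨆ i, (H i).toSubmodule = ⊤
  orthogonal : ∀ i j, i ≠ j → ∀ x ∈ H i, ∀ y ∈ H j, killingForm F L x y = 0

end LieAlgebraPart

attribute [local instance 100] LieRing.ofAssociativeRing

/-- `sl_n(F)` has a classical orthogonal decomposition `H_0 ⊕ H_1 ⊕ ⋯ ⊕ H_n`. -/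
def HasCOD (n : ℕ) (F : Type*) [Field F] : Prop :=
  ∃ H : Fin (n + 1) → LieSubalgebra F (LieAlgebra.SpecialLinear.sl (Fin n) F), IsCOD H

section JMatrices

variable {F : Type*} [Field F]

/-- `D = diag(1, u, …, u^(p-1))`. -/
def matD (p : ℕ) (u : F) : Matrix (Fin p) (Fin p) F :=
  Matrix.diagonal fun i => u ^ (i : ℕ)

/-- The cyclic permutation matrix `P`: column `j` has its `1` in row `j + 1` modulo `p`. -/
def matP (p : ℕ) (F : Type*) [Field F] : Matrix (Fin p) (Fin p) F :=
  Matrix.of fun i j => if (i : ℕ) = ((j : ℕ) + 1) % p then 1 else 0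

/-- `J_(a,b) = D^a P^b` for `a`, `b` in `ℤ/p`. -/
def matJ (p : ℕ) (u : F) (a b : ZMod p) : Matrix (Fin p) (Fin p) F :=
  matD p u ^ a.val * matP p F ^ b.val

/-- The Kronecker product `A 0 ⊗ A 1 ⊗ ⋯ ⊗ A (m-1)`. Indices are written in base `p` with the
leftmost factor at the most significant digit (`finFunctionFinEquiv` puts digit `0` at the least
significant place, hence `Fin.rev`). -/
def kroneckerPow {p m : ℕ} (A : Fin m → Matrix (Fin p) (Fin p) F) :
    Matrix (Fin (p ^ m)) (Fin (p ^ m)) F :=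
  Matrix.of fun i j =>
    ∏ k : Fin m, A k (finFunctionFinEquiv.symm i k.rev) (finFunctionFinEquiv.symm j k.rev)

/-- `J_w` for `w = (x; y)` in `𝔽_(p^m) ⊕ 𝔽_(p^m)`: the Kronecker product of the `J_(a_i,b_i)`,
where the `a_i` are the coordinates of `x` in the basis `e` and the `b_i` those of `y` in `f`. -/
noncomputable def matJw {p m : ℕ} [Fact p.Prime] (u : F)
    (e f : Module.Basis (Fin m) (ZMod p) (GaloisField p m)) (x y : GaloisField p m) :
    Matrix (Fin (p ^ m)) (Fin (p ^ m)) F :=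
  kroneckerPow fun i => matJ p u (e.repr x i) (f.repr y i)

/-- The components of the `J`-decomposition: `H_∞` (index `none`) is the span of the `J_(0;t)` and
`H_α` (index `some α`) is the span of the `J_(t;αt)`, with `t ≠ 0`. -/
noncomputable def jComponent {p m : ℕ} [Fact p.Prime] (u : F)
    (e f : Module.Basis (Fin m) (ZMod p) (GaloisField p m)) :
    Option (GaloisField p m) → Submodule F (Matrix (Fin (p ^ m)) (Fin (p ^ m)) F)
  | none => Submodule.span F {A | ∃ t : GaloisField p m, t ≠ 0 ∧ A = matJw u e f 0 t}
  | some α => Submodule.span F {A | ∃ t : GaloisField p m, t ≠ 0 ∧ A = matJw u e f t (α * t)}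

end JMatrices

/-! The matrices `𝒥_(x;y)` form a finite Heisenberg–Weyl system. Since `e` and `f` are trace-dual,
numbering the rows by `f`-coordinates turns `𝒥_(x;y)` into translation by `y` followed by
multiplication by `z ↦ χ (x z)` on functions on `K = 𝔽_(p^m)`, where `χ = u ^ Tr`
(`matJw_eq_weylMatrix`). These operators multiply up to scalars like `K × K`, and form a basis of
all matrices because only the one at the origin has nonzero trace.

The components are the lines through the origin of `K × K`. The lines partition the nonzero vectors,
which gives the direct sum. For `q + r ≠ 0`, `ad q ∘ ad r` shifts the basis index, so it has trace
zero; this gives orthogonality (`killingForm_weylSl`).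

Each line is isotropic for the symplectic form, so its matrices commute. Their `p`-th powers are
nonzero scalar `p`-th powers, so they are simultaneously diagonalizable, and a dimension count makes
their span conjugate to all diagonal matrices (`exists_conj_span_eq_diagonal`). What remains is the
classical root computation for traceless diagonal matrices (`DiagonalCartan.isClassicalCartan`). -/

open LieAlgebra.SpecialLinear in
/-- The functional `h ↦ dⱼ - dᵢ` on a subalgebra `H` of `sl`, where `d` is the diagonal of `φ h`. -/
def diagDiff {F ι : Type*} [Field F] [Fintype ι] [DecidableEq ι]
    (φ : Matrix ι ι F ≃ₐ[F] Matrix ι ι F) (H : LieSubalgebra F (sl ι F)) (i j : ι) :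
    Module.Dual F H where
  toFun h := φ (h : sl ι F).val j j - φ (h : sl ι F).val i i
  map_add' x y := by simp; ring
  map_smul' c x := by simp; ring

/-! ### Root spaces of the traceless diagonal matrices, up to conjugation. -/

namespace DiagonalCartan

open LieAlgebra.SpecialLinear

variable {F ι : Type*} [Field F] [Fintype ι] [DecidableEq ι]
  {φ : Matrix ι ι F ≃ₐ[F] Matrix ι ι F} {H : LieSubalgebra F (sl ι F)}

lemma mem_sl_iff (x : Matrix ι ι F) : x ∈ sl ι F ↔ x.trace = 0 := Iff.rfl

lemma conj_lie_apply (hH : ∀ x : sl ι F, x ∈ H ↔ (φ x.val).IsDiag) (x : sl ι F) (h : H) (i j : ι) :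
    φ ⁅x, (h : sl ι F)⁆.val i j = φ x.val i j * diagDiff φ H i j h := by
  have hd := ((hH h).1 h.2).diagonal_diag
  rw [sl_bracket, map_sub, map_mul, map_mul, ← hd, Matrix.sub_apply, Matrix.mul_diagonal,
    Matrix.diagonal_mul]
  simp only [diagDiff, LinearMap.coe_mk, AddHom.coe_mk, Matrix.diag_apply]
  ring

/-- Bracketing with a diagonal matrix scales each entry separately, so membership only constrains
the support of `φ x`. -/
lemma mem_rootSpaceOf_iff (hH : ∀ x : sl ι F, x ∈ H ↔ (φ x.val).IsDiag) (α : Module.Dual F H)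
    (x : sl ι F) :
    x ∈ rootSpaceOf H α ↔ ∀ i j, φ x.val i j ≠ 0 → diagDiff φ H i j = α := by
  change (∀ h : H, ⁅x, (h : sl ι F)⁆ = α h • x) ↔ _
  have key : ∀ h : H, ⁅x, (h : sl ι F)⁆ = α h • x ↔
      ∀ i j, φ x.val i j * diagDiff φ H i j h = α h * φ x.val i j := by
    intro h
    rw [← Subtype.coe_inj, ← φ.injective.eq_iff, ← Matrix.ext_iff]
    refine forall₂_congr fun i j => ?_
    rw [conj_lie_apply hH]
    simp
  simp only [key]
  constructor
  · intro hx i j hij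
    ext h
    exact mul_left_cancel₀ hij ((hx h i j).trans (mul_comm _ _))
  · intro hx h i j
    by_cases hij : φ x.val i j = 0
    · simp [hij]
    · rw [hx i j hij, mul_comm]

lemma exists_diagDiff_of_isRootOf (hH : ∀ x : sl ι F, x ∈ H ↔ (φ x.val).IsDiag)
    {α : Module.Dual F H} (hα : IsRootOf H α) : ∃ i j, diagDiff φ H i j = α := by
  obtain ⟨x, hx, hx0⟩ := (Submodule.ne_bot_iff _).1 hα
  rw [mem_rootSpaceOf_iff hH] at hx
  by_contra! hne
  apply hx0
  rw [← Subtype.coe_inj, ← φ.injective.eq_iff]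
  ext i j
  by_contra h
  exact hne i j (hx i j (by simpa using h))

lemma diagDiff_self (i : ι) : diagDiff φ H i i = 0 := by
  ext h; simp [diagDiff]

lemma diagDiff_swap (i j : ι) : diagDiff φ H j i = -diagDiff φ H i j := by
  ext h; simp [diagDiff]

/-- Every index is singled out by an element of `H`. -/
lemma exists_coord (hφ : ∀ x, (φ x).trace = x.trace)
    (hH : ∀ x : sl ι F, x ∈ H ↔ (φ x.val).IsDiag) (hn : (Fintype.card ι : F) ≠ 0) (k : ι) :
    ∃ h : H, ∀ i j, diagDiff φ H i j h = (if j = k then 1 else 0) - if i = k then 1 else 0 := by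
  -- This is `E_kk - 1/n`, traceless because `n` is invertible in `F`.
  set d : Matrix ι ι F :=
    Matrix.diagonal fun i => (if i = k then 1 else 0) - (Fintype.card ι : F)⁻¹ with hd
  have htr : φ.symm d ∈ sl ι F := by
    rw [mem_sl_iff, ← hφ, AlgEquiv.apply_symm_apply, hd, Matrix.trace_diagonal]
    simp [hn]
  have hmem : (⟨φ.symm d, htr⟩ : sl ι F) ∈ H := by
    rw [hH]
    simp [hd]
  refine ⟨⟨_, hmem⟩, fun i j => ?_⟩
  simp [diagDiff, hd]

/-- The elements of `exists_coord` for `k = i` and `k = j` take the values `-1` and `1` on the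
functional of `(i, j)`. As `-1 ≠ 1`, these values detect the row and the column. -/
lemma diagDiff_injective (hφ : ∀ x, (φ x).trace = x.trace)
    (hH : ∀ x : sl ι F, x ∈ H ↔ (φ x.val).IsDiag) (hn : (Fintype.card ι : F) ≠ 0)
    (h2 : (2 : F) ≠ 0) {i j a b : ι} (hij : i ≠ j) (h : diagDiff φ H a b = diagDiff φ H i j) :
    a = i ∧ b = j := by
  have h11 : (-1 : F) ≠ 1 := fun h => h2 (by linear_combination -h)
  have h10 : (-1 : F) ≠ 0 := by simp
  constructor
  · obtain ⟨x, hx⟩ := exists_coord hφ hH hn i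
    have h1 := hx a b
    rw [h, hx i j] at h1
    by_contra hai
    rw [if_neg hij.symm, if_neg hai, if_pos rfl, zero_sub, sub_zero] at h1
    split_ifs at h1
    exacts [h11 h1, h10 h1]
  · obtain ⟨x, hx⟩ := exists_coord hφ hH hn j
    have h1 := hx a b
    rw [h, hx i j] at h1
    by_contra hbj
    rw [if_neg hij, if_neg hbj, if_pos rfl, zero_sub, sub_zero] at h1
    split_ifs at h1
    exacts [h11 h1.symm, absurd h1 (by simp)]

lemma apply_eq_zero_of_ne {α : Module.Dual F H} {x : sl ι F}
    (hH : ∀ x : sl ι F, x ∈ H ↔ (φ x.val).IsDiag) (hx : x ∈ rootSpaceOf H α) {i j : ι}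
    (hij : diagDiff φ H i j ≠ α) : φ x.val i j = 0 := by
  by_contra h
  exact hij ((mem_rootSpaceOf_iff hH α x).1 hx i j h)

lemma iSupIndep_rootSpaceOf (hH : ∀ x : sl ι F, x ∈ H ↔ (φ x.val).IsDiag) :
    iSupIndep (rootSpaceOf H) := by
  intro α
  -- `Z` contains every other root space and constrains exactly the entries where an element of the
  -- `α`-space may be nonzero.
  let Z : Submodule F (sl ι F) :=
    { carrier := {x | ∀ i j, diagDiff φ H i j = α → φ x.val i j = 0}
      zero_mem' := by simp
      add_mem' := by
        intro x y hx hy i j h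
        simp [hx i j h, hy i j h]
      smul_mem' := by
        intro c x hx i j h
        simp [hx i j h] }
  have hle : ⨆ β, ⨆ (_ : β ≠ α), rootSpaceOf H β ≤ Z :=
    iSup₂_le fun β hβ x hx i j h => apply_eq_zero_of_ne hH hx (h.trans_ne hβ.symm)
  refine Disjoint.mono_right hle ?_
  rw [Submodule.disjoint_def]
  intro x hx hxZ
  rw [← Subtype.coe_inj, ← φ.injective.eq_iff]
  ext i j
  by_cases h : diagDiff φ H i j = α
  · simpa using hxZ i j h
  · simpa using apply_eq_zero_of_ne hH hx h

/-- The off-diagonal matrix unit in the coordinates given by `φ`. -/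
lemma exists_single (hφ : ∀ x, (φ x).trace = x.trace) {i j : ι} (hij : i ≠ j) :
    ∃ x : sl ι F, φ x.val = Matrix.single i j 1 := by
  refine ⟨⟨φ.symm (Matrix.single i j 1), ?_⟩, by simp⟩
  rw [mem_sl_iff, ← hφ, AlgEquiv.apply_symm_apply, Matrix.trace_single_eq_of_ne i j _ hij]

lemma mem_rootSpaceOf_of_single (hH : ∀ x : sl ι F, x ∈ H ↔ (φ x.val).IsDiag) {i j : ι}
    {x : sl ι F} (hx : φ x.val = Matrix.single i j 1) : x ∈ rootSpaceOf H (diagDiff φ H i j) := by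
  rw [mem_rootSpaceOf_iff hH]
  intro a b hab
  rw [hx, Matrix.single_apply] at hab
  obtain ⟨rfl, rfl⟩ : i = a ∧ j = b := by
    by_contra h
    simp [h] at hab
  rfl

lemma iSup_rootSpaceOf (hφ : ∀ x, (φ x).trace = x.trace)
    (hH : ∀ x : sl ι F, x ∈ H ↔ (φ x.val).IsDiag) : ⨆ α, rootSpaceOf H α = ⊤ := by
  classical
  rw [eq_top_iff]
  intro x _
  have hex : ∀ q : ι × ι, ∃ y : sl ι F, q.1 ≠ q.2 → φ y.val = Matrix.single q.1 q.2 1 := by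
    intro q
    by_cases h : q.1 = q.2
    · exact ⟨0, fun h' => absurd h h'⟩
    · obtain ⟨y, hy⟩ := exists_single hφ h
      exact ⟨y, fun _ => hy⟩
  choose E hE using hex
  set s : sl ι F := ∑ q : ι × ι with q.1 ≠ q.2, φ x.val q.1 q.2 • E q with hs
  have hsmem : s ∈ ⨆ α, rootSpaceOf H α := by
    refine Submodule.sum_mem _ fun q hq => Submodule.smul_mem _ _ ?_
    exact Submodule.mem_iSup_of_mem _
      (mem_rootSpaceOf_of_single hH (hE q (Finset.mem_filter.1 hq).2))
  have hdiag : (φ (x - s).val).IsDiag := by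
    intro i j hij
    have : φ s.val = ∑ q : ι × ι with q.1 ≠ q.2, φ x.val q.1 q.2 • Matrix.single q.1 q.2 1 := by
      rw [hs, AddSubmonoidClass.coe_finsetSum, map_sum]
      refine Finset.sum_congr rfl fun q hq => ?_
      rw [← hE q (Finset.mem_filter.1 hq).2, ← map_smul]
      rfl
    have hsij : φ s.val i j = φ x.val i j := by
      rw [this, Matrix.sum_apply, Finset.sum_eq_single (i, j)]
      · simp
      · rintro ⟨a, b⟩ - hab
        have : ¬ (a = i ∧ b = j) := by simpa using hab
        simp [this]
      · simp [hij]
    simp [hsij]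
  have hd0 : x - s ∈ rootSpaceOf H 0 := by
    rw [mem_rootSpaceOf_iff hH]
    intro i j hij
    by_cases h : i = j
    · rw [h, diagDiff_self]
    · exact absurd (hdiag h) hij
  have := Submodule.add_mem _ (Submodule.mem_iSup_of_mem _ hd0) hsmem
  simpa using this

lemma eq_smul_single (hφ : ∀ x, (φ x).trace = x.trace)
    (hH : ∀ x : sl ι F, x ∈ H ↔ (φ x.val).IsDiag) (hn : (Fintype.card ι : F) ≠ 0)
    (h2 : (2 : F) ≠ 0) {i j : ι} (hij : i ≠ j) {x y : sl ι F}
    (hx : x ∈ rootSpaceOf H (diagDiff φ H i j)) (hy : φ y.val = Matrix.single i j 1) :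
    x = φ x.val i j • y := by
  rw [← Subtype.coe_inj, ← φ.injective.eq_iff]
  ext a b
  have : φ (φ x.val i j • y).val = φ x.val i j • φ y.val := by
    rw [← map_smul]; rfl
  rw [this, hy]
  by_cases h : i = a ∧ j = b
  · obtain ⟨rfl, rfl⟩ := h
    simp
  · rw [apply_eq_zero_of_ne hH hx]
    · simp [h]
    · intro h'
      obtain ⟨rfl, rfl⟩ := diagDiff_injective hφ hH hn h2 hij h'
      exact h ⟨rfl, rfl⟩

lemma finrank_bracketSpan (hφ : ∀ x, (φ x).trace = x.trace)
    (hH : ∀ x : sl ι F, x ∈ H ↔ (φ x.val).IsDiag) (hn : (Fintype.card ι : F) ≠ 0)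
    (h2 : (2 : F) ≠ 0) {i j : ι} (hij : i ≠ j) :
    Module.finrank F (bracketSpan (rootSpaceOf H (diagDiff φ H i j))
      (rootSpaceOf H (-diagDiff φ H i j))) = 1 := by
  obtain ⟨x, hx⟩ := exists_single hφ hij
  obtain ⟨y, hy⟩ := exists_single hφ hij.symm
  have hxm := mem_rootSpaceOf_of_single hH hx
  have hym := mem_rootSpaceOf_of_single hH hy
  rw [← diagDiff_swap]
  have hspan : bracketSpan (rootSpaceOf H (diagDiff φ H i j)) (rootSpaceOf H (diagDiff φ H j i)) =
      Submodule.span F {⁅x, y⁆} := by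
    apply le_antisymm
    · refine Submodule.span_le.2 ?_
      rintro _ ⟨a, ha, b, hb, rfl⟩
      rw [eq_smul_single hφ hH hn h2 hij ha hx, eq_smul_single hφ hH hn h2 hij.symm hb hy,
        smul_lie, lie_smul]
      exact Submodule.smul_mem _ _ (Submodule.smul_mem _ _ (Submodule.mem_span_singleton_self _))
    · exact Submodule.span_mono (Set.singleton_subset_iff.2 ⟨x, hxm, y, hym, rfl⟩)
  rw [hspan]
  apply finrank_span_singleton
  -- The bracket is `E_ii - E_jj` in these coordinates, with `(i, i)` entry `1`.
  intro h0
  have : φ ⁅x, y⁆.val i i = 0 := by simp [h0]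
  rw [sl_bracket, map_sub, map_mul, map_mul, hx, hy] at this
  simp [hij.symm] at this

/-- On the chosen `h`, roots take only the values `-1, 0, 1`, and `β h = 1`. Some `k ≤ 3` makes `α +
kβ` take the value `2`, which is none of these as `2` and `3` are nonzero in `F`. -/
lemma exists_not_isRootOf (hφ : ∀ x, (φ x).trace = x.trace)
    (hH : ∀ x : sl ι F, x ∈ H ↔ (φ x.val).IsDiag) (hn : (Fintype.card ι : F) ≠ 0)
    (h2 : (2 : F) ≠ 0) (h3 : (3 : F) ≠ 0) (hF : 3 < ringChar F)
    {α β : Module.Dual F H} (hα : IsRootOf H α) (hβ : IsRootOf H β) (hβ0 : β ≠ 0) :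
    ∃ k : ℕ, 1 ≤ k ∧ k < ringChar F ∧ ¬ IsRootOf H (α + k • β) := by
  obtain ⟨i, j, rfl⟩ := exists_diagDiff_of_isRootOf hH hβ
  have hij : i ≠ j := by
    rintro rfl
    exact hβ0 (diagDiff_self i)
  obtain ⟨h, hh⟩ := exists_coord hφ hH hn j
  have hval : ∀ γ : Module.Dual F H, IsRootOf H γ → γ h = -1 ∨ γ h = 0 ∨ γ h = 1 := by
    intro γ hγ
    obtain ⟨a, b, rfl⟩ := exists_diagDiff_of_isRootOf hH hγ
    rw [hh]
    split_ifs <;> simp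
  have hβ1 : diagDiff φ H i j h = 1 := by simp [hh, hij]
  have key : ∀ k : ℕ, α h + k = 2 → ¬ IsRootOf H (α + k • diagDiff φ H i j) := by
    intro k hk hr
    have := hval _ hr
    simp only [LinearMap.add_apply, LinearMap.smul_apply, hβ1, nsmul_eq_mul, mul_one, hk] at this
    rcases this with h | h | h
    · exact h3 (by linear_combination h)
    · exact h2 h
    · exact one_ne_zero (α := F) (by linear_combination h)
  rcases hval α hα with h | h | h
  · exact ⟨3, by omega, by omega, key 3 (by rw [h]; norm_num)⟩
  · exact ⟨2, by omega, by omega, key 2 (by rw [h]; norm_num)⟩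
  · exact ⟨1, by omega, by omega, key 1 (by rw [h]; norm_num)⟩

/-- A subalgebra of `sl` that is conjugate to the traceless diagonal matrices is a classical
Cartan subalgebra. -/
theorem isClassicalCartan (hφ : ∀ x, (φ x).trace = x.trace)
    (hH : ∀ x : sl ι F, x ∈ H ↔ (φ x.val).IsDiag) (hn : (Fintype.card ι : F) ≠ 0)
    (h2 : (2 : F) ≠ 0) (h3 : (3 : F) ≠ 0) (hF : 3 < ringChar F) : IsClassicalCartan H := by
  have hab : IsLieAbelian H := by
    refine ⟨fun x y => ?_⟩
    rw [← Subtype.coe_inj, ← Subtype.coe_inj, ← φ.injective.eq_iff]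
    ext i j
    rw [LieSubalgebra.coe_bracket, conj_lie_apply hH]
    by_cases h : i = j
    · simp [h, diagDiff_self]
    · simp [(hH x).1 x.2 h]
  refine ⟨⟨inferInstance, ?_⟩, hab, iSupIndep_rootSpaceOf hH, iSup_rootSpaceOf hφ hH, ?_,
    fun α β hα hβ hβ0 => exists_not_isRootOf hφ hH hn h2 h3 hF hα hβ hβ0⟩
  · refine le_antisymm (fun x hx => ?_) H.le_normalizer
    rw [hH]
    intro i j hij
    -- This `h` multiplies the `(i, j)` entry by `1`, so a diagonal bracket forces that entry to
    -- vanish.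
    obtain ⟨h, hh⟩ := exists_coord hφ hH hn j
    have hmem : φ ⁅x, (h : sl ι F)⁆.val i j = 0 := (hH _).1 ((H.mem_normalizer_iff x).1 hx h h.2) hij
    rw [conj_lie_apply hH, hh] at hmem
    simpa [hij] using hmem
  · intro α hα0 hα
    obtain ⟨i, j, rfl⟩ := exists_diagDiff_of_isRootOf hH hα
    refine finrank_bracketSpan hφ hH hn h2 ?_
    rintro rfl
    exact hα0 (diagDiff_self i)

end DiagonalCartan

/-! ### Simultaneous diagonalization. -/

section Diagonalization

open Module

lemma sum_pow_eq_zero_of_primitiveRoot {F : Type*} [Field F] {p : ℕ} {u : F}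
    (hu : IsPrimitiveRoot u p) {j : ℕ} (hj0 : 0 < j) (hjp : j < p) :
    ∑ k ∈ Finset.range p, (u ^ k) ^ j = 0 := by
  have h1 : u ^ j ≠ 1 := hu.pow_ne_one_of_pos_of_lt hj0.ne' hjp
  have h2 : (u ^ j - 1) * ∑ k ∈ Finset.range p, (u ^ k) ^ j = 0 := by
    have := mul_geom_sum (u ^ j) p
    rw [← pow_mul, mul_comm j p, pow_mul, hu.pow_eq_one, one_pow, sub_self] at this
    rw [← this]
    congr 1
    exact Finset.sum_congr rfl fun k _ => by rw [← pow_mul, ← pow_mul, mul_comm]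
  exact (mul_eq_zero.1 h2).resolve_left (sub_ne_zero.2 h1)

variable {F V : Type*} [Field F] [AddCommGroup V] [Module F V]

/-- Lagrange interpolation at the roots `t u^k` of `X^p - t^p`: the cofactor `g k` of `X - t u^k`
maps into the corresponding eigenspace, and a combination of the `g k` is an invertible scalar. -/
lemma iSup_eigenspace_eq_top_of_pow_eq {p : ℕ} {u t : F} (hu : IsPrimitiveRoot u p)
    (hp : (p : F) ≠ 0) (ht : t ≠ 0) {f : End F V} (hf : f ^ p = algebraMap F _ (t ^ p)) :
    ⨆ μ, f.eigenspace μ = ⊤ := by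
  have hp0 : 0 < p := Nat.pos_of_ne_zero fun h => hp (by simp [h])
  set g : ℕ → End F V := fun k =>
    ∑ j ∈ Finset.range p, f ^ j * (algebraMap F (End F V) (t * u ^ k)) ^ (p - 1 - j) with hg
  have hmem : ∀ k v, g k v ∈ f.eigenspace (t * u ^ k) := by
    intro k v
    have hcomm : Commute f (algebraMap F (End F V) (t * u ^ k)) :=
      (Algebra.commutes _ _).symm
    have h := hcomm.mul_geom_sum₂ p
    rw [hf, ← map_pow, mul_pow, ← pow_mul, mul_comm k p, pow_mul, hu.pow_eq_one, one_pow, mul_one,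
      sub_self] at h
    rw [End.mem_eigenspace_iff, ← sub_eq_zero]
    exact LinearMap.congr_fun h v
  have hsum : ∑ k ∈ Finset.range p, (t * u ^ k) • g k = algebraMap F _ (p * t ^ p) := by
    have h1 : ∀ k ∈ Finset.range p, (t * u ^ k) • g k =
        ∑ j ∈ Finset.range p, (t ^ (p - j) * (u ^ k) ^ (p - j)) • f ^ j := by
      intro k _
      rw [hg, Finset.smul_sum]
      refine Finset.sum_congr rfl fun j hj => ?_
      rw [← map_pow, ← Algebra.commutes, ← Algebra.smul_def, smul_smul, ← pow_succ', ← mul_pow]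
      congr 2
      have := Finset.mem_range.1 hj
      omega
    -- For `0 < j < p` the coefficient of `f ^ j` contains a vanishing sum of roots of unity; only
    -- `j = 0` survives.
    rw [Finset.sum_congr rfl h1, Finset.sum_comm, Finset.sum_eq_single 0]
    · have h2 : ∀ k ∈ Finset.range p, (t ^ (p - 0) * (u ^ k) ^ (p - 0)) • f ^ 0 =
          algebraMap F _ (t ^ p) := by
        intro k _
        rw [Nat.sub_zero, ← pow_mul, mul_comm k p, pow_mul, hu.pow_eq_one, one_pow, mul_one,
          pow_zero, Algebra.algebraMap_eq_smul_one]
      rw [Finset.sum_congr rfl h2, Finset.sum_const, Finset.card_range, nsmul_eq_mul, map_mul,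
        map_natCast]
    · intro j hj hj0
      have := Finset.mem_range.1 hj
      rw [← Finset.sum_smul, ← Finset.mul_sum,
        sum_pow_eq_zero_of_primitiveRoot hu (by omega) (by omega), mul_zero, zero_smul]
    · simp [hp0.ne']
  rw [eq_top_iff]
  intro v _
  have hv := LinearMap.congr_fun hsum v
  rw [Module.algebraMap_end_apply] at hv
  have hc : (p : F) * t ^ p ≠ 0 := mul_ne_zero hp (pow_ne_zero _ ht)
  rw [← inv_smul_smul₀ hc v, ← hv, LinearMap.sum_apply]
  refine Submodule.smul_mem _ _ (Submodule.sum_mem _ fun k _ => ?_)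
  exact Submodule.smul_mem _ _ (Submodule.mem_iSup_of_mem _ (hmem k v))

lemma isSemisimple_of_pow_eq [FiniteDimensional F V] {p : ℕ} {t : F} (hp : (p : F) ≠ 0)
    (ht : t ≠ 0) {f : End F V} (hf : f ^ p = algebraMap F _ (t ^ p)) : f.IsSemisimple := by
  refine End.isSemisimple_of_squarefree_aeval_eq_zero
    (p := Polynomial.X ^ p - Polynomial.C (t ^ p)) ?_ (by simp [hf])
  exact (Polynomial.separable_X_pow_sub_C _ hp (pow_ne_zero _ ht)).squarefree

/-- A commuting family of endomorphisms whose `p`-th powers are nonzero scalar `p`-th powers has a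
basis of common eigenvectors. -/
lemma exists_basis_eigenvectors [FiniteDimensional F V] {ι κ : Type*} [Fintype ι]
    (hι : Fintype.card ι = finrank F V) {p : ℕ} {u : F} (hu : IsPrimitiveRoot u p)
    (hp : (p : F) ≠ 0) (f : κ → End F V) (hcomm : ∀ a b, Commute (f a) (f b))
    (hf : ∀ a, ∃ t : F, t ≠ 0 ∧ f a ^ p = algebraMap F _ (t ^ p)) :
    ∃ (b : Basis ι F V) (c : ι → κ → F), ∀ i a, f a (b i) = c i a • b i := by
  classical
  have hss : ∀ a, (f a).IsFinitelySemisimple := fun a => by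
    obtain ⟨t, ht, h⟩ := hf a
    exact (isSemisimple_of_pow_eq hp ht h).isFinitelySemisimple
  -- Semisimplicity identifies generalized eigenspaces with eigenspaces, so the joint generalized
  -- decomposition consists of common eigenvectors.
  have htop := End.iSup_iInf_maxGenEigenspace_eq_top_of_iSup_maxGenEigenspace_eq_top_of_commute f
    (fun a b _ => hcomm a b) fun a => by
      obtain ⟨t, ht, h⟩ := hf a
      simp_rw [(hss a).maxGenEigenspace_eq_eigenspace]
      exact iSup_eigenspace_eq_top_of_pow_eq hu hp ht h
  have hind := End.independent_iInf_maxGenEigenspace_of_forall_mapsTo f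
    fun a b μ => End.mapsTo_maxGenEigenspace_of_comm (hcomm b a) μ
  have hint := DirectSum.isInternal_submodule_of_iSupIndep_of_iSup_eq_top hind htop
  let B := hint.collectedBasis fun χ => Module.finBasis F _
  have : Finite (Σ χ : κ → F, Fin (finrank F
    (⨅ a, (f a).maxGenEigenspace (χ a) : Submodule F V))) := Module.Finite.finite_basis B
  let _ := Fintype.ofFinite (Σ χ : κ → F, Fin (finrank F
    (⨅ a, (f a).maxGenEigenspace (χ a) : Submodule F V)))
  let e := Fintype.equivOfCardEq ((Module.finrank_eq_card_basis B).symm.trans hι.symm)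
  refine ⟨B.reindex e, fun i a => (e.symm i).1 a, fun i a => ?_⟩
  have h := hint.collectedBasis_mem (fun χ => Module.finBasis F _) (e.symm i)
  have h' := (Submodule.mem_iInf _).1 h a
  rw [(hss a).maxGenEigenspace_eq_eigenspace, End.mem_eigenspace_iff] at h'
  simpa [B] using h'

/-- A commutative space of `n × n` matrices of dimension `n`, spanned by matrices whose `p`-th
powers are nonzero scalar `p`-th powers, is conjugate to the space of diagonal matrices. -/
lemma exists_conj_span_eq_diagonal {ι κ : Type*} [Fintype ι] [DecidableEq ι] [Fintype κ]
    (hκ : Fintype.card κ = Fintype.card ι) {p : ℕ} {u : F} (hu : IsPrimitiveRoot u p)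
    (hp : (p : F) ≠ 0) {M : κ → Matrix ι ι F} (hM : LinearIndependent F M)
    (hcomm : ∀ a b, Commute (M a) (M b))
    (hf : ∀ a, ∃ t : F, t ≠ 0 ∧ M a ^ p = algebraMap F _ (t ^ p)) :
    ∃ φ : Matrix ι ι F ≃ₐ[F] Matrix ι ι F, (∀ x, (φ x).trace = x.trace) ∧
      ∀ x, x ∈ Submodule.span F (Set.range M) ↔ (φ x).IsDiag := by
  obtain ⟨b, c, hb⟩ := exists_basis_eigenvectors (ι := ι) (V := ι → F) (by simp) hu hp
    (fun a => Matrix.toLinAlgEquiv' (M a)) (fun x y => (hcomm x y).map _) (fun a => by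
      obtain ⟨t, ht, h⟩ := hf a
      exact ⟨t, ht, by rw [← map_pow, h, AlgEquiv.commutes]⟩)
  let φ : Matrix ι ι F ≃ₐ[F] Matrix ι ι F :=
    Matrix.toLinAlgEquiv'.trans (LinearMap.toMatrixAlgEquiv b)
  have hφM : ∀ a, φ (M a) = Matrix.diagonal fun i => c i a := by
    intro a
    ext i j
    simp only [φ, AlgEquiv.trans_apply, LinearMap.toMatrixAlgEquiv_apply, hb]
    by_cases h : i = j
    · simp [h]
    · simp [h]
  refine ⟨φ, fun x => ?_, ?_⟩
  · have h1 := LinearMap.trace_eq_matrix_trace F b (Matrix.toLin' x)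
    rw [Matrix.trace_toLin'_eq] at h1
    exact h1.symm
  · let D : Submodule F (Matrix ι ι F) := LinearMap.range (Matrix.diagonalLinearMap ι F F)
    have hD : ∀ x, x ∈ D ↔ x.IsDiag := by
      intro x
      rw [Matrix.isDiag_iff_diagonal_diag]
      exact ⟨by rintro ⟨d, rfl⟩; simp, fun h => ⟨x.diag, h⟩⟩
    have hmap : (Submodule.span F (Set.range M)).map φ.toLinearMap = D := by
      apply Submodule.eq_of_le_of_finrank_eq
      · rw [Submodule.map_le_iff_le_comap, Submodule.span_le]
        rintro _ ⟨a, rfl⟩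
        exact ⟨_, (hφM a).symm⟩
      · rw [LinearEquiv.finrank_map_eq φ.toLinearEquiv, finrank_span_eq_card hM, hκ,
          LinearMap.finrank_range_of_inj Matrix.diagonal_injective, finrank_fintype_fun_eq_card]
    intro x
    rw [← hD, ← hmap]
    exact ⟨fun h => ⟨x, h, rfl⟩, fun ⟨y, hy, h⟩ => φ.injective h ▸ hy⟩

end Diagonalization

/-! ### Weyl matrices and lines in the plane `K × K`. -/

/-- The Weyl matrix of `(x, y)`: translation by `y` followed by multiplication by `z ↦ χ (x z)`,
on functions on `K`, written in the indexing `σ` of the elements of `K`. -/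
def weylMatrix {F K ι : Type*} [Field F] [Field K] [DecidableEq K] (χ : AddChar K F) (σ : ι ≃ K)
    (q : K × K) : Matrix ι ι F :=
  Matrix.of fun i j => if σ i = σ j + q.2 then χ (q.1 * σ i) else 0

/-- The parametrized lines through the origin of `K × K`, indexed by their slopes. -/
def slopeLine {K : Type*} [Field K] : Option K → K → K × K
  | none, t => (0, t)
  | some a, t => (t, a * t)

section SlopeLine

variable {K : Type*} [Field K]

lemma slopeLine_zero (i : Option K) : slopeLine i 0 = 0 := by
  cases i <;> simp [slopeLine]

lemma slopeLine_injective (i : Option K) : Function.Injective (slopeLine i) := by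
  intro s t h
  cases i <;> simp_all [slopeLine]

lemma slopeLine_ne_zero (i : Option K) {t : K} (ht : t ≠ 0) : slopeLine i t ≠ 0 := fun h =>
  ht (slopeLine_injective i (h.trans (slopeLine_zero i).symm))

lemma neg_slopeLine (i : Option K) (t : K) : -slopeLine i t = slopeLine i (-t) := by
  cases i <;> simp [slopeLine]

lemma exists_slopeLine (q : K × K) : ∃ i t, slopeLine i t = q := by
  obtain ⟨x, y⟩ := q
  by_cases hx : x = 0
  · exact ⟨none, y, by simp [slopeLine, hx]⟩
  · exact ⟨some (y / x), x, by simp [slopeLine, hx]⟩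

lemma eq_of_slopeLine_eq {i j : Option K} {s t : K} (hs : s ≠ 0)
    (h : slopeLine i s = slopeLine j t) : i = j := by
  match i, j, h with
  | none, none, _ => rfl
  | none, some b, h =>
    simp only [slopeLine, Prod.mk.injEq] at h
    exact absurd (by rw [h.2, ← h.1, mul_zero]) hs
  | some a, none, h =>
    simp only [slopeLine, Prod.mk.injEq] at h
    exact absurd h.1 hs
  | some a, some b, h =>
    simp only [slopeLine, Prod.mk.injEq] at h
    rw [← h.1] at h
    rw [mul_right_cancel₀ hs h.2]

/-- Isotropy of lines, the condition under which Weyl matrices commute. -/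
lemma slopeLine_symplectic (i : Option K) (s t : K) :
    (slopeLine i s).1 * (slopeLine i t).2 = (slopeLine i t).1 * (slopeLine i s).2 := by
  cases i <;> simp only [slopeLine] <;> ring

end SlopeLine

/-! ### The orthogonal decomposition from Weyl matrices. -/

namespace Weyl

open Module LieAlgebra.SpecialLinear

variable {F K ι : Type*} [Field F] [Field K] [DecidableEq K] [Fintype ι] [DecidableEq ι]
  (χ : AddChar K F) (σ : ι ≃ K)

omit [Fintype ι] in
lemma weylMatrix_zero : weylMatrix χ σ 0 = 1 := by
  ext i j
  simp [weylMatrix, Matrix.one_apply]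

omit [DecidableEq ι] in
lemma weylMatrix_mul (q r : K × K) :
    weylMatrix χ σ q * weylMatrix χ σ r = χ (-(r.1 * q.2)) • weylMatrix χ σ (q + r) := by
  ext i k
  rw [Matrix.mul_apply, Finset.sum_eq_single (σ.symm (σ i - q.2))]
  · simp only [weylMatrix, Matrix.of_apply, Equiv.apply_symm_apply, sub_add_cancel, if_true,
      Matrix.smul_apply, smul_eq_mul, mul_ite, mul_zero, Prod.fst_add, Prod.snd_add]
    refine if_congr ?_ ?_ rfl
    · constructor <;> intro h <;> linear_combination h
    · rw [← AddChar.map_add_eq_mul, ← AddChar.map_add_eq_mul]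
      congr 1
      ring
  · intro j _ hj
    have : ¬ σ i = σ j + q.2 := fun h => hj (by simp [h])
    simp [weylMatrix, this]
  · simp

omit [DecidableEq ι] in
lemma commute_weylMatrix {q r : K × K} (h : q.1 * r.2 = r.1 * q.2) :
    Commute (weylMatrix χ σ q) (weylMatrix χ σ r) := by
  rw [commute_iff_eq, weylMatrix_mul, weylMatrix_mul, h, add_comm]

lemma weylMatrix_pow (q : K × K) (k : ℕ) :
    weylMatrix χ σ q ^ k = χ (-((k.choose 2 : K) * (q.1 * q.2))) • weylMatrix χ σ (k • q) := by
  induction k with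
  | zero => simp [weylMatrix_zero]
  | succ k ih =>
    rw [pow_succ, ih, Matrix.smul_mul, weylMatrix_mul, smul_smul, ← AddChar.map_add_eq_mul,
      succ_nsmul]
    congr 2
    rw [Nat.choose_succ_succ' k 1, Nat.choose_one_right]
    rw [Prod.smul_snd, nsmul_eq_mul, Nat.cast_add]
    ring

/-- The `p`-th power is the scalar `χ (-(p.choose 2) x y)`. For odd `p`, `p` divides the binomial
and the scalar is `1`; for `p = 2` it is `±1`, and the square root of `-1` makes it a square. -/
lemma exists_weylMatrix_pow_eq {p : ℕ} [hp : Fact p.Prime] [CharP K p]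
    (hF : (p = 2 ∧ IsSquare (-1 : F)) ∨ 2 < p) (q : K × K) :
    ∃ t : F, t ≠ 0 ∧ weylMatrix χ σ q ^ p = algebraMap F _ (t ^ p) := by
  have hpq : p • q = 0 := by ext <;> simp
  rw [weylMatrix_pow, hpq, weylMatrix_zero, ← Algebra.algebraMap_eq_smul_one]
  rcases hF with ⟨rfl, a, ha⟩ | h2
  · have h : χ (-(q.1 * q.2)) * χ (-(q.1 * q.2)) = 1 := by
      rw [← AddChar.map_add_eq_mul, CharTwo.add_self_eq_zero, AddChar.map_zero_eq_one]
    rcases mul_self_eq_one_iff.1 h with h | h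
    · exact ⟨1, one_ne_zero, by simp [h]⟩
    · refine ⟨a, ?_, by simp [h, pow_two, ha]⟩
      rintro rfl
      simp at ha
  · refine ⟨1, one_ne_zero, ?_⟩
    rw [(CharP.cast_eq_zero_iff K p _).2 (hp.out.dvd_choose_self two_ne_zero h2)]
    simp

variable [Fintype K]

variable {χ}

lemma trace_weylMatrix (hχ : χ.IsPrimitive) (q : K × K) :
    (weylMatrix χ σ q).trace = if q = 0 then (Fintype.card ι : F) else 0 := by
  obtain ⟨x, y⟩ := q
  by_cases hy : y = 0
  · have h : (weylMatrix χ σ (x, y)).trace = ∑ z : K, χ (z * x) := by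
      rw [← σ.sum_comp, Matrix.trace]
      exact Finset.sum_congr rfl fun i _ => by simp [weylMatrix, hy, mul_comm]
    rw [h, AddChar.sum_mulShift x hχ]
    simp [hy, Fintype.card_congr σ]
  · simp [weylMatrix, Matrix.trace, hy]

variable (hχ : χ.IsPrimitive)
include hχ

/-- Multiplying by the matrix of `-q` and taking the trace isolates the coefficient at `q`. -/
lemma linearIndependent_weylMatrix (hn : (Fintype.card ι : F) ≠ 0) :
    LinearIndependent F (weylMatrix χ σ) := by
  rw [Fintype.linearIndependent_iff]
  intro c hc q
  have h : (weylMatrix χ σ (-q) * ∑ r, c r • weylMatrix χ σ r).trace = 0 := by simp [hc]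
  rw [Finset.mul_sum, Matrix.trace_sum, Finset.sum_eq_single q] at h
  · rw [Matrix.mul_smul, weylMatrix_mul, Matrix.trace_smul, Matrix.trace_smul,
      trace_weylMatrix σ hχ, neg_add_cancel, if_pos rfl] at h
    simpa [hn, (AddChar.val_isUnit χ _).ne_zero] using h
  · intro r _ hr
    have : -q + r ≠ 0 := fun h => hr (neg_add_eq_zero.1 h).symm
    rw [Matrix.mul_smul, weylMatrix_mul, Matrix.trace_smul, Matrix.trace_smul,
      trace_weylMatrix σ hχ, if_neg this, smul_zero, smul_zero]
  · simp

/-- The traceless Weyl matrices. -/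
def weylSl (q : {q : K × K // q ≠ 0}) : sl ι F :=
  ⟨weylMatrix χ σ q.1, by rw [DiagonalCartan.mem_sl_iff, trace_weylMatrix σ hχ, if_neg q.2]⟩

/-- Allowing the origin only adds the identity, whose trace `n` is nonzero, so it contributes
nothing to a traceless matrix. -/
lemma mem_span_weylSl_iff (hn : (Fintype.card ι : F) ≠ 0) (S : Set (K × K)) (x : sl ι F) :
    x ∈ Submodule.span F (weylSl σ hχ '' (Subtype.val ⁻¹' S)) ↔
      x.val ∈ Submodule.span F (weylMatrix χ σ '' S) := by
  have hmap : (Submodule.span F (weylSl σ hχ '' (Subtype.val ⁻¹' S))).map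
      (sl ι F).toSubmodule.subtype = Submodule.span F (weylMatrix χ σ '' (S \ {0})) := by
    rw [Submodule.map_span, ← Set.image_comp]
    congr 1
    ext A
    constructor
    · rintro ⟨q, hq, rfl⟩
      exact ⟨q, ⟨hq, q.2⟩, rfl⟩
    · rintro ⟨q, hq, rfl⟩
      exact ⟨⟨q, hq.2⟩, hq.1, rfl⟩
  have hmem : x ∈ Submodule.span F (weylSl σ hχ '' (Subtype.val ⁻¹' S)) ↔
      x.val ∈ Submodule.span F (weylMatrix χ σ '' (S \ {0})) := by
    rw [← hmap]
    exact ⟨fun h => ⟨x, h, rfl⟩, fun ⟨y, hy, h⟩ => Subtype.ext h ▸ hy⟩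
  rw [hmem]
  refine ⟨fun h => Submodule.span_mono (Set.image_mono Set.sdiff_subset) h, fun h => ?_⟩
  have h' : x.val ∈ Submodule.span F (insert (weylMatrix χ σ 0) (weylMatrix χ σ '' (S \ {0}))) := by
    refine Submodule.span_mono ?_ h
    rintro _ ⟨q, hq, rfl⟩
    by_cases h0 : q = 0
    · exact Or.inl (by rw [h0])
    · exact Or.inr ⟨q, ⟨hq, h0⟩, rfl⟩
  obtain ⟨a, z, hz, hx⟩ := Submodule.mem_span_insert.1 h'
  have hz0 : z.trace = 0 := by
    have hle : Submodule.span F (weylMatrix χ σ '' (S \ {0})) ≤ (sl ι F).toSubmodule := by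
      rw [Submodule.span_le]
      rintro _ ⟨q, hq, rfl⟩
      exact (weylSl σ hχ ⟨q, hq.2⟩).2
    exact hle hz
  have hx0 : x.val.trace = 0 := x.2
  rw [hx, Matrix.trace_add, hz0, Matrix.trace_smul, trace_weylMatrix σ hχ, if_pos rfl,
    add_zero, smul_eq_mul] at hx0
  rw [hx, (mul_eq_zero.1 hx0).resolve_right hn, zero_smul, zero_add]
  exact hz

lemma span_weylMatrix (hn : (Fintype.card ι : F) ≠ 0) :
    Submodule.span F (Set.range (weylMatrix χ σ)) = ⊤ := by
  apply (linearIndependent_weylMatrix σ hχ hn).span_eq_top_of_card_eq_finrank'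
  simp [Module.finrank_matrix, Fintype.card_congr σ]

/-- The traceless Weyl matrices form a basis of `sl`. -/
noncomputable def weylBasis (hn : (Fintype.card ι : F) ≠ 0) :
    Basis {q : K × K // q ≠ 0} F (sl ι F) :=
  Basis.mk (v := weylSl σ hχ)
    (LinearIndependent.of_comp (sl ι F).toSubmodule.subtype
      ((linearIndependent_weylMatrix σ hχ hn).comp _ Subtype.val_injective))
    (fun x _ => by
      have := (mem_span_weylSl_iff σ hχ hn Set.univ x).2
        (by rw [Set.image_univ, span_weylMatrix σ hχ hn]; trivial)
      simpa using this)

lemma weylBasis_apply (hn : (Fintype.card ι : F) ≠ 0) (q : {q : K × K // q ≠ 0}) :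
    weylBasis σ hχ hn q = weylSl σ hχ q := by
  simp [weylBasis]

omit [DecidableEq ι] [Fintype K] hχ in
lemma exists_lie_weylMatrix (q r : K × K) :
    ∃ c : F, weylMatrix χ σ q * weylMatrix χ σ r - weylMatrix χ σ r * weylMatrix χ σ q =
      c • weylMatrix χ σ (q + r) :=
  ⟨_, by rw [weylMatrix_mul, weylMatrix_mul, add_comm r q, ← sub_smul]⟩

lemma killingForm_weylSl (hn : (Fintype.card ι : F) ≠ 0) {q r : {q : K × K // q ≠ 0}}
    (hqr : q.1 + r.1 ≠ 0) : killingForm F (sl ι F) (weylSl σ hχ q) (weylSl σ hχ r) = 0 := by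
  classical
  rw [killingForm_apply_apply, LinearMap.trace_eq_matrix_trace F (weylBasis σ hχ hn)]
  refine Finset.sum_eq_zero fun v _ => ?_
  rw [Matrix.diag_apply, LinearMap.toMatrix_apply, weylBasis_apply, LinearMap.comp_apply,
    LieAlgebra.ad_apply, LieAlgebra.ad_apply]
  obtain ⟨c, hc⟩ : ∃ c : F, ⁅weylSl σ hχ q, ⁅weylSl σ hχ r, weylSl σ hχ v⁆⁆.val =
      c • weylMatrix χ σ (q.1 + (r.1 + v.1)) := by
    obtain ⟨c, hc⟩ := exists_lie_weylMatrix (χ := χ) σ r.1 v.1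
    obtain ⟨d, hd⟩ := exists_lie_weylMatrix (χ := χ) σ q.1 (r.1 + v.1)
    refine ⟨c * d, ?_⟩
    rw [sl_bracket, sl_bracket]
    simp only [weylSl]
    rw [hc, Matrix.mul_smul, Matrix.smul_mul, ← smul_sub, hd, smul_smul]
  -- The shifted index may be the origin, outside the basis; the double bracket is then a traceless
  -- scalar matrix, hence zero.
  by_cases h0 : q.1 + (r.1 + v.1) = 0
  · have htr : (⁅weylSl σ hχ q, ⁅weylSl σ hχ r, weylSl σ hχ v⁆⁆ : sl ι F).val.trace = 0 :=
      (⁅weylSl σ hχ q, ⁅weylSl σ hχ r, weylSl σ hχ v⁆⁆ : sl ι F).2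
    rw [hc, Matrix.trace_smul, trace_weylMatrix σ hχ, if_pos h0, smul_eq_mul] at htr
    rw [(mul_eq_zero.1 htr).resolve_right hn, zero_smul] at hc
    rw [show ⁅weylSl σ hχ q, ⁅weylSl σ hχ r, weylSl σ hχ v⁆⁆ = 0 from Subtype.ext hc]
    simp
  · rw [show ⁅weylSl σ hχ q, ⁅weylSl σ hχ r, weylSl σ hχ v⁆⁆ =
      c • weylBasis σ hχ hn ⟨_, h0⟩ from Subtype.ext (by rw [hc, weylBasis_apply]; rfl)]
    have hne : (⟨q.1 + (r.1 + v.1), h0⟩ : {q : K × K // q ≠ 0}) ≠ v := by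
      intro h
      have h1 := congrArg Subtype.val h
      exact hqr (by simpa [← add_assoc] using h1)
    simp [Finsupp.single_eq_of_ne' hne]

/-- For every slope the traceless Weyl matrices on the line span a subalgebra that is conjugate to
the traceless diagonal matrices. -/
lemma exists_conj_slopeLine (hn : (Fintype.card ι : F) ≠ 0) {p : ℕ} [Fact p.Prime]
    [CharP K p] (hF : (p = 2 ∧ IsSquare (-1 : F)) ∨ 2 < p) (hpF : (p : F) ≠ 0) {u : F}
    (hu : IsPrimitiveRoot u p) (i : Option K) :
    ∃ φ : Matrix ι ι F ≃ₐ[F] Matrix ι ι F, (∀ x, (φ x).trace = x.trace) ∧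
      ∀ x : sl ι F, x ∈ Submodule.span F
        (weylSl σ hχ '' (Subtype.val ⁻¹' Set.range (slopeLine i))) ↔ (φ x.val).IsDiag := by
  obtain ⟨φ, hφ, h⟩ := exists_conj_span_eq_diagonal (Fintype.card_congr σ.symm) hu hpF
    ((linearIndependent_weylMatrix σ hχ hn).comp _ (slopeLine_injective i))
    (fun s t => commute_weylMatrix χ σ (slopeLine_symplectic i s t))
    (fun t => exists_weylMatrix_pow_eq χ σ hF _)
  refine ⟨φ, hφ, fun x => ?_⟩
  rw [mem_span_weylSl_iff σ hχ hn, ← h, Set.range_comp]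

/-- The lines through the origin of `K × K` give a classical orthogonal decomposition of `sl`. -/
theorem exists_isCOD (hn : (Fintype.card ι : F) ≠ 0) {p : ℕ} [Fact p.Prime] [CharP K p]
    (hF : (p = 2 ∧ IsSquare (-1 : F)) ∨ 2 < p) (hpF : (p : F) ≠ 0) {u : F}
    (hu : IsPrimitiveRoot u p) (h2 : (2 : F) ≠ 0) (h3 : (3 : F) ≠ 0) (hchar : 3 < ringChar F) :
    ∃ H : Option K → LieSubalgebra F (sl ι F), IsCOD H ∧
      ∀ i, (H i).toSubmodule.map (sl ι F).toSubmodule.subtype =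
        Submodule.span F {A | ∃ t : K, t ≠ 0 ∧ A = weylMatrix χ σ (slopeLine i t)} := by
  choose φ hφ hd using exists_conj_slopeLine σ hχ hn hF hpF hu
  let S : Option K → Set {q : K × K // q ≠ 0} := fun i => Subtype.val ⁻¹' Set.range (slopeLine i)
  let H : Option K → LieSubalgebra F (sl ι F) := fun i =>
    { Submodule.span F (weylSl σ hχ '' S i) with
      lie_mem' := by
        intro x y hx hy
        have hx' := ((hd i x).1 hx).diagonal_diag
        have hy' := ((hd i y).1 hy).diagonal_diag
        refine (hd i _).2 ?_
        rw [sl_bracket, map_sub, map_mul, map_mul, ← hx', ← hy', Matrix.diagonal_mul_diagonal,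
          Matrix.diagonal_mul_diagonal]
        simp [mul_comm, Matrix.isDiag_zero] }
  have hH : ∀ i, (H i).toSubmodule = Submodule.span F (weylBasis σ hχ hn '' S i) := by
    intro i
    rw [show (weylBasis σ hχ hn : _ → sl ι F) = weylSl σ hχ from
      funext fun q => weylBasis_apply σ hχ hn q]
  have hS : ∀ i j, i ≠ j → ∀ q ∈ S i, q ∉ S j := by
    rintro i j hij q ⟨s, hs⟩ ⟨t, ht⟩
    refine hij (eq_of_slopeLine_eq (s := s) ?_ (hs.trans ht.symm))
    rintro rfl
    exact q.2 (hs.symm.trans (slopeLine_zero i))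
  refine ⟨H, ⟨fun i => ?_, ?_, ?_, ?_⟩, fun i => ?_⟩
  · exact DiagonalCartan.isClassicalCartan (hφ i) (hd i) hn h2 h3 hchar
  · intro i
    simp only [hH, ← Submodule.span_iUnion, ← Set.image_iUnion]
    refine (weylBasis σ hχ hn).linearIndependent.disjoint_span_image ?_
    rw [Set.disjoint_left]
    intro q hq hq'
    obtain ⟨j, hj, hqj⟩ := Set.mem_iUnion₂.1 hq'
    exact hS i j (Ne.symm hj) q hq hqj
  · simp only [hH, ← Submodule.span_iUnion, ← Set.image_iUnion]
    have : ⋃ i, S i = Set.univ := Set.eq_univ_of_forall fun q => by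
      obtain ⟨i, t, h⟩ := exists_slopeLine q.1
      exact Set.mem_iUnion.2 ⟨i, t, h⟩
    rw [this, Set.image_univ, Basis.span_eq]
  · intro i j hij x hx y hy
    refine Submodule.span_induction₂ (p := fun x y _ _ => killingForm F (sl ι F) x y = 0)
      ?_ ?_ ?_ ?_ ?_ ?_ ?_ hx hy
    · rintro _ _ ⟨q, hq, rfl⟩ ⟨r, hr, rfl⟩
      -- Lines are closed under negation, so `q + r = 0` would put `q` on both lines.
      refine killingForm_weylSl σ hχ hn fun h => hS i j hij q hq ?_
      obtain ⟨t, ht⟩ := hr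
      exact ⟨-t, by rw [← neg_slopeLine, ht, eq_neg_of_add_eq_zero_left h]⟩
    · simp
    · simp
    · intro x y z _ _ _ h h'
      rw [map_add, LinearMap.add_apply, h, h', add_zero]
    · intro x y z _ _ _ h h'
      rw [map_add, h, h', add_zero]
    · intro c x y _ _ h
      rw [map_smul, LinearMap.smul_apply, h, smul_zero]
    · intro c x y _ _ h
      rw [map_smul, h, smul_zero]
  · rw [show (H i).toSubmodule = Submodule.span F (weylSl σ hχ '' S i) from rfl,
      Submodule.map_span, ← Set.image_comp]
    congr 1
    ext A
    constructor
    · rintro ⟨q, ⟨t, ht⟩, rfl⟩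
      refine ⟨t, ?_, by rw [ht]; rfl⟩
      rintro rfl
      exact q.2 (ht.symm.trans (slopeLine_zero i))
    · rintro ⟨t, ht, rfl⟩
      exact ⟨⟨_, slopeLine_ne_zero i ht⟩, ⟨t, rfl⟩, rfl⟩

end Weyl

/-! ### Entries of `J_(a,b)`: Weyl matrices over `ℤ/p`. -/

section JMatrixEntries

variable {F : Type*} [Field F] {p : ℕ}

lemma matP_pow_apply (k : ℕ) (i j : Fin p) :
    (matP p F ^ k) i j = if (i : ℕ) = ((j : ℕ) + k) % p then 1 else 0 := by
  induction k generalizing j with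
  | zero =>
    rw [pow_zero, Matrix.one_apply]
    simp [Nat.mod_eq_of_lt j.2, Fin.ext_iff]
  | succ k ih =>
    have hp : 0 < p := j.pos
    rw [pow_succ, Matrix.mul_apply, Finset.sum_eq_single ⟨((j : ℕ) + 1) % p, Nat.mod_lt _ hp⟩]
    · rw [ih]
      simp only [matP, Matrix.of_apply, if_true, mul_one, Nat.mod_add_mod]
      rw [add_assoc, add_comm 1 k]
    · intro l _ hl
      have : ¬ (l : ℕ) = ((j : ℕ) + 1) % p := fun h => hl (Fin.ext h)
      simp [matP, this]
    · simp

variable [NeZero p] {u : F}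

lemma matJ_apply (hu : u ^ p = 1) (a b : ZMod p) (i j : Fin p) :
    matJ p u a b i j = if ((i : ℕ) : ZMod p) = ((j : ℕ) : ZMod p) + b then
      AddChar.zmodChar p hu (a * ((i : ℕ) : ZMod p)) else 0 := by
  have h1 : (i : ℕ) = ((j : ℕ) + b.val) % p ↔ ((i : ℕ) : ZMod p) = ((j : ℕ) : ZMod p) + b := by
    have := ZMod.natCast_eq_natCast_iff' (i : ℕ) ((j : ℕ) + b.val) p
    rw [Nat.mod_eq_of_lt i.2, Nat.cast_add, ZMod.natCast_zmod_val] at this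
    exact this.symm
  have h2 : AddChar.zmodChar p hu (a * ((i : ℕ) : ZMod p)) = (u ^ (i : ℕ)) ^ a.val := by
    have := AddChar.zmodChar_apply' hu (a.val * (i : ℕ))
    rw [Nat.cast_mul, ZMod.natCast_zmod_val] at this
    rw [this, mul_comm, pow_mul]
  rw [matJ, matD, Matrix.diagonal_pow, Matrix.diagonal_mul, matP_pow_apply, h2, mul_ite, mul_one,
    mul_zero]
  exact if_congr h1 rfl rfl

end JMatrixEntries

/-! ### Identification of the `J`-matrices with Weyl matrices over `𝔽_(p^m)`. -/

section JDecomposition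

open Module

variable {F : Type*} [Field F] {p m : ℕ} [hp : Fact p.Prime]

/-- The residues `0, …, p - 1` modulo `p`. -/
noncomputable def finEquivZMod (p : ℕ) [NeZero p] : Fin p ≃ ZMod p :=
  Equiv.ofBijective (fun i => ((i : ℕ) : ZMod p)) <| by
    rw [Fintype.bijective_iff_injective_and_card]
    refine ⟨fun i j h => ?_, by simp [ZMod.card]⟩
    have := (ZMod.natCast_eq_natCast_iff' (i : ℕ) (j : ℕ) p).1 h
    rw [Nat.mod_eq_of_lt i.2, Nat.mod_eq_of_lt j.2] at this
    exact Fin.ext this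

/-- The elements of `𝔽_(p^m)` numbered by their coordinates in a basis, read as digits. -/
noncomputable def digitEquiv (f : Basis (Fin m) (ZMod p) (GaloisField p m)) :
    Fin (p ^ m) ≃ GaloisField p m :=
  finFunctionFinEquiv.symm.trans
    ((Equiv.arrowCongr Fin.revPerm (finEquivZMod p)).trans f.equivFun.symm.toEquiv)

/-- The reversal `k.rev` matches the digit order of `kroneckerPow`, so the `k`-th Kronecker factor
sees the `k`-th `f`-coordinate. -/
lemma repr_digitEquiv (f : Basis (Fin m) (ZMod p) (GaloisField p m)) (i : Fin (p ^ m))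
    (k : Fin m) :
    f.repr (digitEquiv f i) k = ((finFunctionFinEquiv.symm i k.rev : ℕ) : ZMod p) := by
  have : f.equivFun (digitEquiv f i) k =
      ((finFunctionFinEquiv.symm i k.rev : ℕ) : ZMod p) := by
    simp only [digitEquiv, Equiv.trans_apply, LinearEquiv.coe_toEquiv,
      LinearEquiv.apply_symm_apply]
    rfl
  exact this

lemma trace_mul_eq_sum {e f : Basis (Fin m) (ZMod p) (GaloisField p m)}
    (hef : ∀ i j, Algebra.trace (ZMod p) (GaloisField p m) (e i * f j) = if i = j then 1 else 0)
    (x y : GaloisField p m) :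
    Algebra.trace (ZMod p) (GaloisField p m) (x * y) = ∑ k, e.repr x k * f.repr y k := by
  conv_lhs => rw [← e.sum_repr x, ← f.sum_repr y]
  simp only [Finset.sum_mul_sum, smul_mul_smul_comm, map_sum, map_smul, hef, smul_eq_mul, mul_ite,
    mul_one, mul_zero, Finset.sum_ite_eq, Finset.mem_univ, if_true]

/-- The additive character `z ↦ u ^ Tr z` of `𝔽_(p^m)`. -/
noncomputable def traceChar (m : ℕ) {u : F} (hu : u ^ p = 1) : AddChar (GaloisField p m) F :=
  (AddChar.zmodChar p hu).compAddMonoidHom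
    (Algebra.trace (ZMod p) (GaloisField p m)).toAddMonoidHom

lemma traceChar_apply {u : F} (hu : u ^ p = 1) (z : GaloisField p m) :
    traceChar m hu z = AddChar.zmodChar p hu (Algebra.trace (ZMod p) (GaloisField p m) z) := rfl

/-- On a field a nontrivial additive character is primitive; surjectivity of the trace supplies a
point with value `u ≠ 1`. -/
lemma isPrimitive_traceChar {u : F} (hu : IsPrimitiveRoot u p) :
    (traceChar m hu.pow_eq_one).IsPrimitive := by
  apply AddChar.IsPrimitive.of_ne_one
  intro h
  obtain ⟨z, hz⟩ := Algebra.trace_surjective (ZMod p) (GaloisField p m) 1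
  have h1 := traceChar_apply hu.pow_eq_one z
  have h2 := AddChar.zmodChar_apply' hu.pow_eq_one 1
  rw [Nat.cast_one, pow_one] at h2
  rw [h, hz, h2, AddChar.one_apply] at h1
  exact hu.ne_one hp.out.one_lt h1.symm

/-- Coordinatewise translations assemble to translation by `y`; the product of the local characters
is `u ^ Tr (x z)` by duality of `e` and `f`. -/
lemma matJw_eq_weylMatrix [DecidableEq (GaloisField p m)]
    {e f : Basis (Fin m) (ZMod p) (GaloisField p m)}
    (hef : ∀ i j, Algebra.trace (ZMod p) (GaloisField p m) (e i * f j) = if i = j then 1 else 0)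
    {u : F} (hu : u ^ p = 1) (x y : GaloisField p m) :
    matJw u e f x y = weylMatrix (traceChar m hu) (digitEquiv f) (x, y) := by
  ext i j
  simp only [matJw, kroneckerPow, weylMatrix, Matrix.of_apply, matJ_apply hu, ← repr_digitEquiv f]
  rw [Finset.prod_ite_zero]
  have h1 : (∀ k ∈ Finset.univ, f.repr (digitEquiv f i) k =
      f.repr (digitEquiv f j) k + f.repr y k) ↔ digitEquiv f i = digitEquiv f j + y := by
    simp [f.ext_elem_iff]
  have h2 : ∏ k, AddChar.zmodChar p hu (e.repr x k * f.repr (digitEquiv f i) k) =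
      traceChar m hu (x * digitEquiv f i) := by
    rw [traceChar_apply, trace_mul_eq_sum hef]
    exact (map_prod (AddChar.zmodChar p hu).toMonoidHom _ _).symm
  rw [h2]
  by_cases h : digitEquiv f i = digitEquiv f j + y
  · rw [if_pos h, if_pos (h1.2 h)]
  · rw [if_neg h, if_neg (h1.not.2 h)]

lemma jComponent_eq [DecidableEq (GaloisField p m)]
    {e f : Basis (Fin m) (ZMod p) (GaloisField p m)}
    (hef : ∀ i j, Algebra.trace (ZMod p) (GaloisField p m) (e i * f j) = if i = j then 1 else 0)
    {u : F} (hu : u ^ p = 1) (i : Option (GaloisField p m)) :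
    jComponent u e f i = Submodule.span F {A | ∃ t, t ≠ 0 ∧
      A = weylMatrix (traceChar m hu) (digitEquiv f) (slopeLine i t)} := by
  cases i <;> simp only [jComponent, slopeLine, matJw_eq_weylMatrix hef hu]

lemma exists_trace_dual_bases (hm : m ≠ 0) :
    ∃ e f : Basis (Fin m) (ZMod p) (GaloisField p m),
      ∀ i j, Algebra.trace (ZMod p) (GaloisField p m) (e i * f j) = if i = j then 1 else 0 := by
  let e := finBasisOfFinrankEq (ZMod p) (GaloisField p m) (GaloisField.finrank p hm)
  exact ⟨e, (Algebra.traceForm _ _).dualBasis (traceForm_nondegenerate _ _) e,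
    LinearMap.BilinForm.apply_dualBasis_right _ (Algebra.traceForm_isSymm _) e⟩

end JDecomposition

lemma IsCOD.comp_equiv {F L ι κ : Type*} [Field F] [LieRing L] [LieAlgebra F L]
    {H : ι → LieSubalgebra F L} (h : IsCOD H) (e : κ ≃ ι) : IsCOD (H ∘ e) where
  classical k := h.classical (e k)
  independent := h.independent.comp e.injective
  iSup_eq_top := (e.iSup_comp (g := fun i => (H i).toSubmodule)).trans h.iSup_eq_top
  orthogonal _ _ hij := h.orthogonal _ _ (e.injective.ne hij)

theorem theorem2p1 {F : Type*} [Field F] (p m : ℕ) [Fact p.Prime] (hm : 1 ≤ m)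
    (hpos : ringChar F ≠ 0) (h2 : ringChar F ≠ 2) (h3 : ringChar F ≠ 3) (hp : ringChar F ≠ p)
    (hF : (p = 2 ∧ IsSquare (-1 : F)) ∨ (2 < p ∧ ∃ u : F, IsPrimitiveRoot u p)) :
    HasCOD (p ^ m) F ∧
      ∀ u : F, IsPrimitiveRoot u p →
        ∀ e f : Module.Basis (Fin m) (ZMod p) (GaloisField p m),
          (∀ i j, Algebra.trace (ZMod p) (GaloisField p m) (e i * f j) = if i = j then 1 else 0) →
          ∃ H : Option (GaloisField p m) →
              LieSubalgebra F (LieAlgebra.SpecialLinear.sl (Fin (p ^ m)) F),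
            IsCOD H ∧
              ∀ i, (H i).toSubmodule.map
                  (LieAlgebra.SpecialLinear.sl (Fin (p ^ m)) F).toSubmodule.subtype =
                jComponent u e f i := by
  classical
  have hprime : p.Prime := Fact.out
  have hchar : (ringChar F).Prime :=
    (CharP.char_is_prime_or_zero F (ringChar F)).resolve_right hpos
  have hcast : ∀ q : ℕ, q.Prime → ringChar F ≠ q → (q : F) ≠ 0 := fun q hq hne h =>
    hne ((Nat.prime_dvd_prime_iff_eq hchar hq).1 ((ringChar.spec F q).1 h))
  have hpF := hcast p hprime hp
  have h2F : (2 : F) ≠ 0 := by exact_mod_cast hcast 2 Nat.prime_two h2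
  have h3F : (3 : F) ≠ 0 := by exact_mod_cast hcast 3 Nat.prime_three h3
  have h3lt : 3 < ringChar F := by
    have := hchar.two_le
    omega
  have hn : (Fintype.card (Fin (p ^ m)) : F) ≠ 0 := by simpa using fun h => absurd h hpF
  let _ := Fintype.ofFinite (GaloisField p m)
  have main : ∀ u : F, IsPrimitiveRoot u p →
      ∀ e f : Module.Basis (Fin m) (ZMod p) (GaloisField p m),
        (∀ i j, Algebra.trace (ZMod p) (GaloisField p m) (e i * f j) = if i = j then 1 else 0) →
        ∃ H : Option (GaloisField p m) →
            LieSubalgebra F (LieAlgebra.SpecialLinear.sl (Fin (p ^ m)) F),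
          IsCOD H ∧
            ∀ i, (H i).toSubmodule.map
                (LieAlgebra.SpecialLinear.sl (Fin (p ^ m)) F).toSubmodule.subtype =
              jComponent u e f i := by
    intro u hu e f hef
    obtain ⟨H, hH, hspan⟩ := Weyl.exists_isCOD (digitEquiv f) (isPrimitive_traceChar hu) hn
      (hF.imp_right And.left) hpF hu h2F h3F h3lt
    exact ⟨H, hH, fun i => (hspan i).trans (jComponent_eq hef hu.pow_eq_one i).symm⟩
  refine ⟨?_, main⟩
  have hu : ∃ u : F, IsPrimitiveRoot u p := by
    rcases hF with ⟨rfl, -⟩ | ⟨-, h⟩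
    · exact ⟨-1, IsPrimitiveRoot.neg_one (ringChar F) h2⟩
    · exact h
  obtain ⟨u, hu⟩ := hu
  obtain ⟨e, f, hef⟩ := exists_trace_dual_bases (p := p) (by omega : m ≠ 0)
  obtain ⟨H, hH, -⟩ := main u hu e f hef
  -- The `p^m` finite slopes and the infinite one are renumbered by `Fin (p ^ m + 1)`.
  have hcard : Fintype.card (Fin (p ^ m + 1)) = Fintype.card (Option (GaloisField p m)) := by
    rw [Fintype.card_fin, Fintype.card_option, ← Fintype.card_congr (digitEquiv f),
      Fintype.card_fin]
  exact ⟨_, hH.comp_equiv (Fintype.equivOfCardEq hcard)⟩
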